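/- Let $q$ be a prime power, let $m\ge 1$ and $\nu$ be integers with $0\le\nu\le m(q-1)-1$, and let $\mathcal R_{q^2}(\nu,m)\subseteq\mathbf F_{q^2}^{q^{2m}}$ be the generalized Reed--Muller code of order $\nu$, that is, the set of all words $(f(P))_{P\in\mathbf F_{q^2}^m}$ with $f\in\mathbf F_{q^2}[x_1,\dots,x_m]$ of total degree at most $\nu$. Put $$k(\nu)=\sum_{j=0}^m(-1)^j\binom mj\binom{m+\nu-jq^2}{\nu-jq^2},\qquad d(\nu^\perp)=(R+1)q^{2A},$$ where a binomial coefficient with negative lower entry is $0$, and $A,R$ are the integers with $\nu+1=(q^2-1)A+R$ and $0\le R<q^2-1$. Then $k(\nu)$ is the dimension of $\mathcal R_{q^2}(\nu,m)$, $d(\nu^\perp)$ is the minimum distance of its Euclidean dual $\mathcal R_{q^2}(\nu,m)^\perp$, and there exists a pure $[[q^{2m},\,q^{2m}-2k(\nu),\,d(\nu^\perp)]]_q$ quantum stabilizer code. Here, for $q$ a power of the prime $p$, an $[[n,k,d]]_q$ stabilizer code is a subspace $Q\subseteq\mathbf C^{q^n}$ of dimension $q^k$ that is the joint $+1$-eigenspace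 of an abelian subgroup of the error group $\{c\,X(a)Z(b): a,b\in\mathbf F_q^n\}$ ($c$ running over the $p$-th roots of unity, or the fourth roots of unity if $p=2$), where $X(a)|x\rangle=|x+a\rangle$ and $Z(b)|x\rangle=e^{2\pi i\,\mathrm{tr}(b\cdot x)/p}|x\rangle$ with $\mathrm{tr}$ the trace from $\mathbf F_q$ to $\mathbf F_p$. The weight of $cX(a)Z(b)$ is the number of $i$ with $(a_i,b_i)\neq(0,0)$; an error $E$ is detected by $Q$ if $PEP$ is a scalar multiple of the orthogonal projector $P$ onto $Q$. The code has minimum distance $d$ if it detects all errors of weight less than $d$ but not all errors of weight $d$, and it is pure if no non-scalar error of weight less than $d$ fixes $Q$ pointwise. -/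

import Mathlib

/-! ### Generalized Reed-Muller codes -/

section Classical

variable (K : Type*) [Field K] [Fintype K]

/-- The generalized Reed-Muller code of order `ν` in `m` variables over the finite field `K`:
the words `(f(P))_P`, indexed by the points `P` of `K^m`, for `f` a polynomial in `m` variables of
total degree at most `ν`. -/
noncomputable def grmCode (ν m : ℕ) : Submodule K ((Fin m → K) → K) :=
  (MvPolynomial.restrictTotalDegree (Fin m) K ν).map (MvPolynomial.evalₗ K (Fin m))

/-- The Euclidean dual of a linear code. -/
def euclideanDual {K : Type*} [Field K] {ι : Type*} [Fintype ι] (C : Submodule K (ι → K)) :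
    Submodule K (ι → K) where
  carrier := {y | ∀ x ∈ C, ∑ i, x i * y i = 0}
  add_mem' := by
    intro y z hy hz x hx
    simp only [Pi.add_apply, mul_add, Finset.sum_add_distrib, hy x hx, hz x hx, add_zero]
  zero_mem' := by
    intro x _
    simp
  smul_mem' := by
    intro c y hy x hx
    have h : ∀ i, x i * (c • y) i = c * (x i * y i) := fun i => by
      simp only [Pi.smul_apply, smul_eq_mul]
      ring
    simp only [h, ← Finset.mul_sum, hy x hx, mul_zero]

/-- `d` is the minimum distance of the linear code `C`, i.e. the smallest Hamming weight of a
nonzero codeword. -/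
def HasMinDistance {K : Type*} [Field K] [DecidableEq K] {ι : Type*} [Fintype ι]
    (C : Submodule K (ι → K)) (d : ℕ) : Prop :=
  IsLeast {w : ℕ | ∃ x ∈ C, x ≠ 0 ∧ hammingNorm x = w} d

end Classical

/-- `∑_{j=0}^m (-1)^j (m choose j) (m+ν-jQ choose ν-jQ)`, where a binomial coefficient with a
negative lower entry is zero. -/
def grmDim (Q ν m : ℕ) : ℤ :=
  ∑ j ∈ Finset.range (m + 1),
    if j * Q ≤ ν then
      (-1 : ℤ) ^ j * (m.choose j : ℤ) * ((m + (ν - j * Q)).choose (ν - j * Q) : ℤ)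
    else 0

/-- `(R + 1) Q ^ A`, where `ν + 1 = (Q - 1) A + R` with `0 ≤ R < Q - 1`. -/
def grmDualDist (Q ν : ℕ) : ℕ :=
  ((ν + 1) % (Q - 1) + 1) * Q ^ ((ν + 1) / (Q - 1))

/-! ### Quantum stabilizer codes -/

section Quantum

/-- The additive character `x ↦ exp (2 π i tr(x) / p)` of a finite field `F` of characteristic `p`,
with `tr` the absolute trace from `F` to the prime field. -/
noncomputable def traceChar (F : Type*) [Field F] [Finite F] : AddChar F ℂ :=
  letI : Algebra (ZMod (ringChar F)) F := ZMod.algebra F (ringChar F)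
  haveI : NeZero (ringChar F) := ⟨CharP.ringChar_ne_zero_of_finite F⟩
  (ZMod.stdAddChar (N := ringChar F)).compAddMonoidHom
    (Algebra.trace (ZMod (ringChar F)) F).toAddMonoidHom

variable {F : Type*} [Field F] [Fintype F] {n : ℕ}

/-- The state space `(ℂ^q)^{⊗ n} = ℂ^{q^n}` of `n` qudits, with orthonormal basis `|x⟩` indexed by
`x ∈ F^n`, where `F` is the field with `q` elements. -/
abbrev QuditSpace (F : Type*) [Fintype F] (n : ℕ) : Type _ := EuclideanSpace ℂ (Fin n → F)

/-- The shift operator `X(a) : |x⟩ ↦ |x + a⟩`. -/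
noncomputable def shiftOp (a : Fin n → F) : QuditSpace F n →ₗ[ℂ] QuditSpace F n where
  toFun ψ := WithLp.toLp 2 fun y => ψ (y - a)
  map_add' ψ φ := by ext y; simp
  map_smul' c ψ := by ext y; simp

/-- The phase operator `Z(b) : |x⟩ ↦ exp (2 π i tr(b · x) / p) |x⟩`. -/
noncomputable def phaseOp (b : Fin n → F) : QuditSpace F n →ₗ[ℂ] QuditSpace F n where
  toFun ψ := WithLp.toLp 2 fun y => traceChar F (∑ i, b i * y i) * ψ y
  map_add' ψ φ := by ext y; simp [mul_add]
  map_smul' c ψ := by ext y; simp [mul_left_comm]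

/-- The error operator `X(a) Z(b)`. These operators form a basis of all operators on the state
space, and those of weight at most `w` span the errors that affect at most `w` qudits. -/
noncomputable def errorOp (a b : Fin n → F) : QuditSpace F n →ₗ[ℂ] QuditSpace F n :=
  shiftOp a ∘ₗ phaseOp b

/-- The weight of `X(a) Z(b)`: the number of qudits on which it does not act as the identity. -/
def errorWeight [DecidableEq F] (a b : Fin n → F) : ℕ :=
  hammingNorm fun i => (a i, b i)

/-- The phases in the error group: the `p`-th roots of unity if the characteristic `p` is odd, and
the fourth roots of unity if `p = 2`. -/
def IsErrorPhase (F : Type*) [Field F] (c : ℂ) : Prop :=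
  c ^ (if ringChar F = 2 then 4 else ringChar F) = 1

/-- Membership in the error group `{c X(a) Z(b)}`. -/
def IsErrorGroupElement (E : QuditSpace F n →ₗ[ℂ] QuditSpace F n) : Prop :=
  ∃ (c : ℂ) (a b : Fin n → F), IsErrorPhase F c ∧ E = c • errorOp a b

/-- A stabilizer code: a nonzero subspace that is the joint eigenspace with eigenvalue `1` of an
abelian subgroup of the error group. -/
def IsStabilizerCode (Q : Submodule ℂ (QuditSpace F n)) : Prop :=
  Q ≠ ⊥ ∧ ∃ S : Subgroup (QuditSpace F n ≃ₗ[ℂ] QuditSpace F n),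
    (∀ E ∈ S, IsErrorGroupElement (E : QuditSpace F n →ₗ[ℂ] QuditSpace F n)) ∧
    (∀ E ∈ S, ∀ E' ∈ S, E * E' = E' * E) ∧
    ∀ ψ : QuditSpace F n, ψ ∈ Q ↔ ∀ E ∈ S, E ψ = ψ

/-- The code `Q`, with orthogonal projector `P`, detects the error `E`: `P E P = c P` for some
scalar `c`. -/
def Detects (Q : Submodule ℂ (QuditSpace F n)) (E : QuditSpace F n →ₗ[ℂ] QuditSpace F n) : Prop :=
  ∃ c : ℂ, ∀ u ∈ Q, ∀ v ∈ Q, inner ℂ u (E v) = c * inner ℂ u v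

/-- The quantum code `Q` (of dimension at least two) has minimum distance exactly `d`: it detects
all errors of weight less than `d`, and it does not detect some error of weight `d`. -/
def HasQuantumMinDistance [DecidableEq F] (Q : Submodule ℂ (QuditSpace F n)) (d : ℕ) : Prop :=
  (∀ a b : Fin n → F, errorWeight a b < d → Detects Q (errorOp a b)) ∧
    ∃ a b : Fin n → F, errorWeight a b = d ∧ ¬ Detects Q (errorOp a b)

/-- The code `Q` is pure to `d`: its stabilizer, i.e. the group of all elements of the error group
that fix `Q` pointwise, contains no non-scalar element of weight less than `d`. -/
def IsPureTo [DecidableEq F] (Q : Submodule ℂ (QuditSpace F n)) (d : ℕ) : Prop :=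
  ∀ (c : ℂ) (a b : Fin n → F), IsErrorPhase F c → (∀ ψ ∈ Q, c • errorOp a b ψ = ψ) →
    errorWeight a b = 0 ∨ d ≤ errorWeight a b

/-- `Q` is a pure `[[n, k, d]]_q` stabilizer code: a stabilizer code on `n` qudits of dimension
`q ^ k`, with minimum distance `d`, that is pure to its minimum distance. -/
def IsPureStabilizerCode [DecidableEq F] (Q : Submodule ℂ (QuditSpace F n)) (k d : ℕ) : Prop :=
  IsStabilizerCode Q ∧ Module.finrank ℂ Q = Fintype.card F ^ k ∧
    HasQuantumMinDistance Q d ∧ IsPureTo Q d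

end Quantum

/-!
The quantum code comes from the stabilizer construction applied to `C = R(ν)`, the generalized
Reed-Muller code of order `ν` over the field `K` with `Q = q²` elements.

*Classical part.* Since `x ^ Q = x` on `K`, the code `C` is spanned by the words of the reduced
monomials of degree at most `ν`, whose exponents are all less than `Q`. All `Q ^ m` reduced
monomials together span the space of words, so they are independent, and `dim C` is the number of
those of degree at most `ν`; splitting off one variable shows that this number satisfies the same
recursion as the alternating sum (`finrank_grmCode_eq_grmDim`). A nonzero word orthogonal to all
monomials of degree less than `s` has weight at least `dualDist Q s` (`dualDist_le_hammingNorm`),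
by induction on the number of variables: if `j` is the least order for which the moment of the
word in one coordinate is not identically zero, then that moment is orthogonal to all monomials of
degree less than `s - j`, and by a Vandermonde argument each point where it does not vanish carries
at least `j + 1` nonzero entries of the word. A product of linear polynomials attains the bound
(`exists_mem_grmCode_hammingNorm_eq`); it is orthogonal to `C` because polynomials of degree less
than `m (Q - 1)` sum to zero over `K ^ m`.

*Quantum part.* A group `D` of labels `(a, b)` that is isotropic for the symplectic form gives
commuting operators `X(a) Z(b)`. They have a common eigenvector, and its eigenvalues `l` normalise
them to the group of the operators `l(v)⁻¹ E(v)`, without any choice of square roots of phases. The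
average of this group is the projector onto the code, and since every `X(a) Z(b)` other than the
identity has trace zero, the trace of the projector gives the dimension of the code and shows that
errors in the symplectic complement of `D` but outside `D` are not detected. Errors outside the
complement map the code to an orthogonal space (`exists_stabilizerCode`).

*Gluing.* For `γ ∈ K` outside the field `F` with `q` elements, `(a, b) ↦ a + γ b` identifies labels
with words over `K`, and the symplectic form becomes the skew part of the Hermitian form
`∑ x y ^ q`, up to a factor. The code `C` is Hermitian self-orthogonal, because
`ν + q ν < m (Q - 1)`. Its Hermitian dual is the conjugate of its Euclidean dual, so it has minimum
distance `dualDist Q (ν + 1)`. The least weight words of the Hermitian dual do not lie in `C`, since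
words of `C` are orthogonal to all polynomials of degree at most `ν + 1` as well and hence have
weight at least `dualDist Q (ν + 2)`; so the code is pure and its distance is exact.
-/

/-! ### The error group -/

section ErrorGroup

open LinearMap

theorem traceChar_exists_ne_one (F : Type*) [Field F] [Finite F] {a : F} (ha : a ≠ 0) :
    ∃ b : F, traceChar F (a * b) ≠ 1 := by
  let _ : Algebra (ZMod (ringChar F)) F := ZMod.algebra F (ringChar F)
  have : NeZero (ringChar F) := ⟨CharP.ringChar_ne_zero_of_finite F⟩
  obtain ⟨b, hb⟩ := FiniteField.trace_to_zmod_nondegenerate F ha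
  refine ⟨b, fun h => hb ?_⟩
  apply ZMod.injective_stdAddChar (N := ringChar F)
  rw [AddChar.map_zero_eq_one]
  exact h

theorem traceChar_pow_ringChar (F : Type*) [Field F] [Finite F] (x : F) :
    traceChar F x ^ ringChar F = 1 := by
  rw [← AddChar.map_nsmul_eq_pow, nsmul_eq_mul, ringChar.Nat.cast_ringChar, zero_mul,
    AddChar.map_zero_eq_one]

variable {F : Type*} [Field F] {n : ℕ}

theorem errorWeight_eq_zero [DecidableEq F] {a b : Fin n → F} :
    errorWeight a b = 0 ↔ a = 0 ∧ b = 0 := by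
  rw [errorWeight, hammingNorm_eq_zero]
  simp [funext_iff, forall_and]

theorem isErrorPhase_of_pow_ringChar {c : ℂ} (h : c ^ ringChar F = 1) : IsErrorPhase F c := by
  unfold IsErrorPhase
  split_ifs with h2
  · rw [h2] at h
    rw [show (4 : ℕ) = 2 * 2 from rfl, pow_mul, h, one_pow]
  · exact h

theorem IsErrorPhase.inv {c : ℂ} (hc : IsErrorPhase F c) : IsErrorPhase F c⁻¹ := by
  unfold IsErrorPhase at *
  rw [inv_pow, hc, inv_one]

variable [Fintype F]

theorem traceChar_ne_zero (x : F) : traceChar F x ≠ 0 := fun h => by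
  have := traceChar_pow_ringChar F x
  rw [h, zero_pow (CharP.ringChar_ne_zero_of_finite F)] at this
  exact zero_ne_one this

theorem IsErrorPhase.norm_eq_one {c : ℂ} (hc : IsErrorPhase F c) : ‖c‖ = 1 := by
  refine Complex.norm_eq_one_of_pow_eq_one hc ?_
  split_ifs
  · norm_num
  · exact CharP.ringChar_ne_zero_of_finite F

theorem IsErrorPhase.ne_zero {c : ℂ} (hc : IsErrorPhase F c) : c ≠ 0 := by
  rw [← norm_ne_zero_iff, hc.norm_eq_one]
  exact one_ne_zero

theorem isErrorPhase_traceChar (x : F) : IsErrorPhase F (traceChar F x) :=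
  isErrorPhase_of_pow_ringChar (traceChar_pow_ringChar F x)

theorem errorOp_apply (a b : Fin n → F) (ψ : QuditSpace F n) (y : Fin n → F) :
    errorOp a b ψ y = traceChar F (b ⬝ᵥ (y - a)) * ψ (y - a) := rfl

theorem errorOp_zero : errorOp (0 : Fin n → F) 0 = LinearMap.id := by
  ext ψ y
  simp [errorOp_apply]

/-- The multiplication rule of the error group. -/
theorem errorOp_errorOp (a b a' b' : Fin n → F) (ψ : QuditSpace F n) :
    errorOp a b (errorOp a' b' ψ) =
      traceChar F (b ⬝ᵥ a') • errorOp (a + a') (b + b') ψ := by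
  ext y
  have h : b ⬝ᵥ (y - a) + b' ⬝ᵥ (y - a - a') =
      b ⬝ᵥ a' + (b + b') ⬝ᵥ (y - (a + a')) := by
    simp only [dotProduct_sub, add_dotProduct, dotProduct_add]
    ring
  rw [PiLp.smul_apply, smul_eq_mul, errorOp_apply, errorOp_apply, errorOp_apply, ← mul_assoc,
    ← mul_assoc, ← AddChar.map_add_eq_mul, ← AddChar.map_add_eq_mul, h, sub_sub]

theorem errorOp_neg_errorOp (a b : Fin n → F) (ψ : QuditSpace F n) :
    errorOp (-a) (-b) (errorOp a b ψ) = traceChar F (-(b ⬝ᵥ a)) • ψ := by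
  rw [errorOp_errorOp, neg_add_cancel, neg_add_cancel, errorOp_zero, neg_dotProduct,
    LinearMap.id_apply]

theorem errorOp_injective (a b : Fin n → F) : Function.Injective (errorOp a b) := by
  rw [← LinearMap.ker_eq_bot, LinearMap.ker_eq_bot']
  intro ψ h
  have := errorOp_neg_errorOp a b ψ
  rw [h, map_zero, eq_comm, smul_eq_zero] at this
  exact this.resolve_left (traceChar_ne_zero _)

/-- Two error operators commute up to the value of the trace character at the symplectic product
of their labels. -/
theorem errorOp_comm (a b a' b' : Fin n → F) (ψ : QuditSpace F n) :
    errorOp a b (errorOp a' b' ψ) =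
      traceChar F (b ⬝ᵥ a' - b' ⬝ᵥ a) • errorOp a' b' (errorOp a b ψ) := by
  rw [errorOp_errorOp, errorOp_errorOp, smul_smul, ← AddChar.map_add_eq_mul, sub_add_cancel,
    add_comm a', add_comm b']

theorem inner_errorOp (a b : Fin n → F) (ψ φ : QuditSpace F n) :
    inner ℂ (errorOp a b ψ) (errorOp a b φ) = inner ℂ ψ φ := by
  simp only [PiLp.inner_apply]
  rw [← (Equiv.subRight a).sum_comp fun y => inner ℂ (ψ y) (φ y)]
  refine Finset.sum_congr rfl fun y _ => ?_
  have h : (starRingEnd ℂ) (traceChar F (b ⬝ᵥ (y - a))) * traceChar F (b ⬝ᵥ (y - a)) = 1 := by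
    rw [mul_comm, Complex.mul_conj, Complex.normSq_eq_norm_sq,
      (isErrorPhase_traceChar _).norm_eq_one]
    simp
  simp only [errorOp_apply, RCLike.inner_apply, map_mul, Equiv.subRight_apply]
  linear_combination (φ (y - a) * (starRingEnd ℂ) (ψ (y - a))) * h

theorem trace_errorOp_eq_zero {a b : Fin n → F} (hab : (a, b) ≠ 0) :
    LinearMap.trace ℂ (QuditSpace F n) (errorOp a b) = 0 := by
  classical
  rw [LinearMap.trace_eq_matrix_trace ℂ (EuclideanSpace.basisFun (Fin n → F) ℂ).toBasis,
    Matrix.trace]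
  have hd : ∀ y, (LinearMap.toMatrix (EuclideanSpace.basisFun (Fin n → F) ℂ).toBasis
      (EuclideanSpace.basisFun (Fin n → F) ℂ).toBasis (errorOp a b)).diag y =
      if a = 0 then traceChar F (b ⬝ᵥ y) else 0 := by
    intro y
    rw [Matrix.diag_apply, LinearMap.toMatrix_apply]
    simp only [OrthonormalBasis.coe_toBasis, EuclideanSpace.basisFun_apply,
      OrthonormalBasis.coe_toBasis_repr_apply, EuclideanSpace.basisFun_repr, errorOp_apply]
    by_cases ha : a = 0
    · simp [ha]
    · simp [ha]
  rw [Finset.sum_congr rfl fun y _ => hd y]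
  by_cases ha : a = 0
  · have hb : b ≠ 0 := fun hb => hab (by rw [ha, hb]; rfl)
    simp only [ha, if_true]
    obtain ⟨i, hi⟩ := Function.ne_iff.1 hb
    obtain ⟨t, ht⟩ := traceChar_exists_ne_one F hi
    let χ : AddChar (Fin n → F) ℂ :=
      (traceChar F).compAddMonoidHom
        (AddMonoidHom.mk' (fun y => b ⬝ᵥ y) fun x y => dotProduct_add b x y)
    have hχ : χ ≠ 1 := by
      refine (AddChar.ne_one_iff).2 ⟨Pi.single i t, ?_⟩
      change traceChar F (b ⬝ᵥ Pi.single i t) ≠ 1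
      rwa [dotProduct_single]
    exact AddChar.sum_eq_zero_of_ne_one hχ
  · simp [ha]

end ErrorGroup

/-! ### Stabilizer codes from isotropic groups of errors -/

section Stabilizer

theorem exists_common_eigenvector {V ι : Type*} [AddCommGroup V] [Module ℂ V]
    [FiniteDimensional ℂ V] [Nontrivial V] (f : ι → V →ₗ[ℂ] V)
    (hf : ∀ i j v, f i (f j v) = f j (f i v)) :
    ∃ v ≠ 0, ∀ i, ∃ c : ℂ, f i v = c • v := by
  -- On a minimal nonzero invariant subspace each operator is a scalar.
  obtain ⟨W, ⟨hW0, hW⟩, hmin⟩ := wellFounded_lt.has_min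
    {W : Submodule ℂ V | W ≠ ⊥ ∧ ∀ i, ∀ v ∈ W, f i v ∈ W} ⟨⊤, top_ne_bot, by simp⟩
  obtain ⟨w, hwW, hw0⟩ := W.ne_bot_iff.1 hW0
  refine ⟨w, hw0, fun i => ?_⟩
  have : Nontrivial W := Submodule.nontrivial_iff_ne_bot.2 hW0
  obtain ⟨c, hc⟩ := Module.End.exists_eigenvalue ((f i).restrict (hW i))
  obtain ⟨u, hu⟩ := hc.exists_hasEigenvector
  have hle : W ⊓ Module.End.eigenspace (f i) c = W := by
    by_contra hne
    refine hmin (W ⊓ Module.End.eigenspace (f i) c) ⟨?_, ?_⟩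
      (lt_of_le_of_ne inf_le_left hne)
    · refine (Submodule.ne_bot_iff _).2 ⟨u, ⟨u.2, ?_⟩, fun h => hu.2 (Subtype.ext h)⟩
      have h := congrArg Subtype.val hu.apply_eq_smul
      exact Module.End.mem_eigenspace_iff.2 h
    · rintro j v ⟨hv, hvc⟩
      refine ⟨hW j v hv, Module.End.mem_eigenspace_iff.2 ?_⟩
      rw [hf, Module.End.mem_eigenspace_iff.1 hvc, map_smul]
  rw [← hle] at hwW
  exact ⟨c, Module.End.mem_eigenspace_iff.1 hwW.2⟩

open LinearMap

variable {F : Type*} [Field F] [Fintype F] {n : ℕ}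

/-- `l` is a system of joint eigenvalues of the operators `X(a) Z(b)` with `(a, b) ∈ D`: it never
vanishes on `D` and multiplies like these operators do. -/
structure IsEigenSystem (D : AddSubgroup ((Fin n → F) × (Fin n → F)))
    (l : (Fin n → F) × (Fin n → F) → ℂ) : Prop where
  ne_zero : ∀ v ∈ D, l v ≠ 0
  mul_eq : ∀ v ∈ D, ∀ w ∈ D, l v * l w = traceChar F (v.2 ⬝ᵥ w.1) * l (v + w)

theorem IsEigenSystem.map_zero {D : AddSubgroup ((Fin n → F) × (Fin n → F))}
    {l : (Fin n → F) × (Fin n → F) → ℂ} (hl : IsEigenSystem D l) : l 0 = 1 := by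
  have h := hl.mul_eq 0 D.zero_mem 0 D.zero_mem
  simp only [Prod.snd_zero, zero_dotProduct, AddChar.map_zero_eq_one, one_mul, add_zero] at h
  exact mul_right_cancel₀ (hl.ne_zero 0 D.zero_mem) (h.trans (one_mul _).symm)

theorem IsEigenSystem.pow_eq {D : AddSubgroup ((Fin n → F) × (Fin n → F))}
    {l : (Fin n → F) × (Fin n → F) → ℂ} (hl : IsEigenSystem D l)
    {v : (Fin n → F) × (Fin n → F)} (hv : v ∈ D) (k : ℕ) :
    l v ^ k = traceChar F (v.2 ⬝ᵥ v.1) ^ (k.choose 2) * l (k • v) := by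
  induction k with
  | zero => simp [hl.map_zero]
  | succ k ih =>
    have h := hl.mul_eq (k • v) (D.nsmul_mem hv k) v hv
    rw [Prod.smul_snd, smul_dotProduct, AddChar.map_nsmul_eq_pow] at h
    rw [pow_succ, ih, mul_assoc, h, Nat.choose_succ_succ' k 1, Nat.choose_one_right, succ_nsmul,
      pow_add, ← mul_assoc, mul_comm (_ ^ k.choose 2)]

/-- The `p`-th power of an error operator is a scalar, which is `1` for odd `p` and `± 1` for
`p = 2`; hence the eigenvalues are phases of the error group. -/
theorem IsEigenSystem.isErrorPhase {D : AddSubgroup ((Fin n → F) × (Fin n → F))}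
    {l : (Fin n → F) × (Fin n → F) → ℂ} (hl : IsEigenSystem D l)
    {v : (Fin n → F) × (Fin n → F)} (hv : v ∈ D) : IsErrorPhase F (l v) := by
  have hp : (ringChar F).Prime := CharP.char_is_prime F _
  have hpv : ringChar F • v = 0 := by
    ext i <;> simp [nsmul_eq_mul]
  have h := hl.pow_eq hv (ringChar F)
  rw [hpv, hl.map_zero, mul_one] at h
  have hχ := traceChar_pow_ringChar F (v.2 ⬝ᵥ v.1)
  unfold IsErrorPhase
  split_ifs with h2
  · rw [h2] at h hχ
    rw [show (4 : ℕ) = 2 * 2 from rfl, pow_mul, h]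
    simpa using hχ
  · obtain ⟨c, hc⟩ : ringChar F ∣ (ringChar F).choose 2 :=
      hp.dvd_choose_self two_ne_zero (lt_of_le_of_ne hp.two_le (Ne.symm h2))
    rw [h, hc, pow_mul, hχ, one_pow]

/-- The joint eigenspace of the error operators with labels in `D` for the eigenvalues `l`. -/
def jointEigenspace (D : AddSubgroup ((Fin n → F) × (Fin n → F)))
    (l : (Fin n → F) × (Fin n → F) → ℂ) : Submodule ℂ (QuditSpace F n) where
  carrier := {ψ | ∀ v ∈ D, errorOp v.1 v.2 ψ = l v • ψ}
  add_mem' hψ hφ v hv := by rw [map_add, hψ v hv, hφ v hv, smul_add]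
  zero_mem' v _ := by rw [map_zero, smul_zero]
  smul_mem' c ψ hψ v hv := by rw [map_smul, hψ v hv, smul_comm]

theorem exists_isEigenSystem (D : AddSubgroup ((Fin n → F) × (Fin n → F)))
    (hD : ∀ v ∈ D, ∀ w ∈ D, v.2 ⬝ᵥ w.1 = w.2 ⬝ᵥ v.1) :
    ∃ l, IsEigenSystem D l ∧ jointEigenspace D l ≠ ⊥ := by
  obtain ⟨ψ, hψ, h⟩ := exists_common_eigenvector
    (fun v : D => errorOp (v : (Fin n → F) × (Fin n → F)).1 (v : (Fin n → F) × (Fin n → F)).2)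
    (fun v w φ => by
      rw [errorOp_comm, hD v v.2 w w.2, sub_self, AddChar.map_zero_eq_one, one_smul])
  choose c hc using h
  classical
  let l : (Fin n → F) × (Fin n → F) → ℂ := fun v => if hv : v ∈ D then c ⟨v, hv⟩ else 0
  have hl : ∀ v ∈ D, errorOp v.1 v.2 ψ = l v • ψ := fun v hv => by
    simp only [l, hv, dif_pos]
    exact hc ⟨v, hv⟩
  refine ⟨l, ⟨fun v hv h0 => hψ ?_, fun v hv w hw => ?_⟩,
    (Submodule.ne_bot_iff _).2 ⟨ψ, hl, hψ⟩⟩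
  · apply errorOp_injective v.1 v.2
    rw [hl v hv, h0, zero_smul, map_zero]
  · have h := errorOp_errorOp v.1 v.2 w.1 w.2 ψ
    rw [hl w hw, map_smul, hl v hv, ← Prod.fst_add, ← Prod.snd_add, hl _ (D.add_mem hv hw),
      smul_smul, smul_smul] at h
    rw [mul_comm]
    exact smul_left_injective ℂ hψ h

variable {D : AddSubgroup ((Fin n → F) × (Fin n → F))} {l : (Fin n → F) × (Fin n → F) → ℂ}

theorem isStabilizerCode_jointEigenspace (hD : ∀ v ∈ D, ∀ w ∈ D, v.2 ⬝ᵥ w.1 = w.2 ⬝ᵥ v.1)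
    (hl : IsEigenSystem D l) (h0 : jointEigenspace D l ≠ ⊥) :
    IsStabilizerCode (jointEigenspace D l) := by
  obtain ⟨ψ₀, hψ₀, hne⟩ := (Submodule.ne_bot_iff _).1 h0
  let S : Subgroup (QuditSpace F n ≃ₗ[ℂ] QuditSpace F n) :=
    { carrier := {E | ∃ v ∈ D, ∀ ψ, E ψ = (l v)⁻¹ • errorOp v.1 v.2 ψ}
      mul_mem' := by
        rintro E E' ⟨v, hv, hE⟩ ⟨w, hw, hE'⟩
        refine ⟨v + w, D.add_mem hv hw, fun ψ => ?_⟩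
        have hχ := traceChar_ne_zero (v.2 ⬝ᵥ w.1)
        rw [LinearEquiv.mul_apply, hE', hE, map_smul, errorOp_errorOp, smul_smul, smul_smul,
          ← mul_inv, hl.mul_eq v hv w hw, mul_inv, mul_right_comm, inv_mul_cancel₀ hχ, one_mul]
        rfl
      one_mem' := ⟨0, D.zero_mem, fun ψ => by
        rw [hl.map_zero, inv_one, one_smul]
        change ψ = errorOp 0 0 ψ
        rw [errorOp_zero]
        rfl⟩
      inv_mem' := by
        rintro E ⟨v, hv, hE⟩
        refine ⟨-v, D.neg_mem hv, fun ψ => ?_⟩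
        obtain ⟨φ, rfl⟩ := E.surjective ψ
        have h := hl.mul_eq (-v) (D.neg_mem hv) v hv
        rw [neg_add_cancel, hl.map_zero, mul_one, Prod.snd_neg, neg_dotProduct] at h
        change E.symm (E φ) = _
        rw [E.symm_apply_apply, hE, map_smul, Prod.fst_neg, Prod.snd_neg, errorOp_neg_errorOp,
          smul_smul, smul_smul, ← mul_inv, h, inv_mul_cancel₀ (traceChar_ne_zero _), one_smul] }
  refine ⟨h0, S, ?_, ?_, fun ψ => ⟨?_, fun h v hv => ?_⟩⟩
  · rintro E ⟨v, hv, hE⟩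
    exact ⟨(l v)⁻¹, v.1, v.2, (hl.isErrorPhase hv).inv, LinearMap.ext hE⟩
  · rintro E ⟨v, hv, hE⟩ E' ⟨w, hw, hE'⟩
    ext1 ψ
    rw [LinearEquiv.mul_apply, LinearEquiv.mul_apply, hE, hE', hE', hE, map_smul, map_smul,
      errorOp_comm, hD v hv w hw, sub_self, AddChar.map_zero_eq_one, one_smul, smul_comm]
  · rintro hψ E ⟨v, hv, hE⟩
    rw [hE, hψ v hv, smul_smul, inv_mul_cancel₀ (hl.ne_zero v hv), one_smul]
  · have hinj : Function.Injective ((l v)⁻¹ • errorOp v.1 v.2) :=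
      (smul_right_injective _ (inv_ne_zero (hl.ne_zero v hv))).comp (errorOp_injective v.1 v.2)
    have h' : (l v)⁻¹ • errorOp v.1 v.2 ψ = ψ :=
      h (LinearEquiv.ofInjectiveEndo _ hinj) ⟨v, hv, fun φ => rfl⟩
    rw [← smul_right_injective _ (inv_ne_zero (hl.ne_zero v hv)) |>.eq_iff, smul_smul,
      inv_mul_cancel₀ (hl.ne_zero v hv), one_smul]
    exact h'

/-- The average over `D` of the error operators, normalised by their eigenvalues: the projector
onto the joint eigenspace. -/
noncomputable def eigenProj (D : AddSubgroup ((Fin n → F) × (Fin n → F)))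
    (l : (Fin n → F) × (Fin n → F) → ℂ) : QuditSpace F n →ₗ[ℂ] QuditSpace F n :=
  (Nat.card D : ℂ)⁻¹ • ∑ᶠ v : D, (l v)⁻¹ • errorOp v.1.1 v.1.2

theorem eigenProj_isProj (hl : IsEigenSystem D l) :
    LinearMap.IsProj (jointEigenspace D l) (eigenProj D l) := by
  classical
  have : Fintype D := Fintype.ofFinite D
  have hP : ∀ ψ, eigenProj D l ψ =
      (Nat.card D : ℂ)⁻¹ • ∑ v : D, (l v)⁻¹ • errorOp v.1.1 v.1.2 ψ := fun ψ => by
    simp [eigenProj, finsum_eq_sum_of_fintype, LinearMap.sum_apply]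
  constructor
  · intro ψ w hw
    rw [hP, map_smul, smul_comm (l w), map_sum]
    congr 1
    rw [Finset.smul_sum, ← Equiv.sum_comp (Equiv.addLeft (⟨w, hw⟩ : D)) fun v : D =>
      l w • (l v)⁻¹ • errorOp v.1.1 v.1.2 ψ]
    refine Finset.sum_congr rfl fun v _ => ?_
    have h := hl.mul_eq w hw v v.2
    have h1 := hl.ne_zero v v.2
    have h2 := hl.ne_zero _ (D.add_mem hw v.2)
    rw [map_smul, errorOp_errorOp, smul_smul, smul_smul]
    change _ = (l w * (l (w + v))⁻¹) • errorOp (w.1 + v.1.1) (w.2 + v.1.2) ψ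
    congr 1
    field_simp
    linear_combination -h
  · intro ψ hψ
    have : ∀ v : D, (l v)⁻¹ • errorOp v.1.1 v.1.2 ψ = ψ := fun v => by
      rw [hψ v v.2, smul_smul, inv_mul_cancel₀ (hl.ne_zero v v.2), one_smul]
    rw [hP, Finset.sum_congr rfl fun v _ => this v, Finset.sum_const, Finset.card_univ,
      ← Nat.card_eq_fintype_card, ← Nat.cast_smul_eq_nsmul ℂ, smul_smul, inv_mul_cancel₀,
      one_smul]
    exact Nat.cast_ne_zero.2 Nat.card_pos.ne'

theorem trace_errorOp_comp_eigenProj {w : (Fin n → F) × (Fin n → F)} (hw : w ∉ D) :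
    LinearMap.trace ℂ _ (errorOp w.1 w.2 ∘ₗ eigenProj D l) = 0 := by
  have : Fintype D := Fintype.ofFinite D
  have hcomp : errorOp w.1 w.2 ∘ₗ eigenProj D l = (Nat.card D : ℂ)⁻¹ • ∑ v : D, (l v)⁻¹ •
      traceChar F (w.2 ⬝ᵥ v.1.1) • errorOp (w.1 + v.1.1) (w.2 + v.1.2) := by
    ext1 ψ
    simp [eigenProj, finsum_eq_sum_of_fintype, LinearMap.sum_apply, map_sum, errorOp_errorOp]
  rw [hcomp, map_smul, map_sum, Finset.sum_eq_zero, smul_zero]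
  intro v _
  rw [map_smul, map_smul, trace_errorOp_eq_zero, smul_zero, smul_zero]
  intro h
  exact hw ((eq_neg_of_add_eq_zero_left h : w = -v.1) ▸ D.neg_mem v.2)

theorem trace_eigenProj (hl : IsEigenSystem D l) :
    LinearMap.trace ℂ _ (eigenProj D l) = (Nat.card D : ℂ)⁻¹ * (Fintype.card F ^ n : ℕ) := by
  classical
  have : Fintype D := Fintype.ofFinite D
  rw [eigenProj, finsum_eq_sum_of_fintype, map_smul, map_sum, Finset.sum_eq_single 0]
  · have h0 : errorOp (0 : D).1.1 (0 : D).1.2 = LinearMap.id := errorOp_zero (F := F) (n := n)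
    rw [h0, map_smul, LinearMap.trace_id, ZeroMemClass.coe_zero, hl.map_zero]
    simp
  · intro v _ hv
    rw [map_smul, trace_errorOp_eq_zero, smul_zero]
    exact fun h => hv (Subtype.ext h)
  · simp

theorem card_mul_finrank_jointEigenspace (hl : IsEigenSystem D l) :
    Nat.card D * Module.finrank ℂ (jointEigenspace D l) = Fintype.card F ^ n := by
  have h := trace_eigenProj hl
  rw [(eigenProj_isProj hl).trace] at h
  have hc : (Nat.card D : ℂ) ≠ 0 := Nat.cast_ne_zero.2 Nat.card_pos.ne'
  rw [eq_inv_mul_iff_mul_eq₀ hc] at h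
  exact_mod_cast h

/-- An error that does not commute with some stabilizer maps the code to an orthogonal space. -/
theorem inner_errorOp_eq_zero (hl : IsEigenSystem D l) {w v : (Fin n → F) × (Fin n → F)}
    (hv : v ∈ D) (hχ : traceChar F (v.2 ⬝ᵥ w.1 - w.2 ⬝ᵥ v.1) ≠ 1) {ψ φ : QuditSpace F n}
    (hψ : ψ ∈ jointEigenspace D l) (hφ : φ ∈ jointEigenspace D l) :
    inner ℂ ψ (errorOp w.1 w.2 φ) = 0 := by
  have h := inner_errorOp v.1 v.2 ψ (errorOp w.1 w.2 φ)
  have hn : (starRingEnd ℂ) (l v) * l v = 1 := by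
    rw [mul_comm, Complex.mul_conj, Complex.normSq_eq_norm_sq, (hl.isErrorPhase hv).norm_eq_one]
    simp
  rw [errorOp_comm, hψ v hv, hφ v hv, map_smul, smul_smul, inner_smul_left, inner_smul_right] at h
  have h' : (traceChar F (v.2 ⬝ᵥ w.1 - w.2 ⬝ᵥ v.1) - 1) *
      inner ℂ ψ (errorOp w.1 w.2 φ) = 0 := by
    linear_combination h -
      traceChar F (v.2 ⬝ᵥ w.1 - w.2 ⬝ᵥ v.1) * inner ℂ ψ (errorOp w.1 w.2 φ) * hn
  exact (mul_eq_zero.1 h').resolve_left (sub_ne_zero.2 hχ)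

/-- An error outside `D` that commutes with all stabilizers acts on the code as a non-scalar
operator: a scalar action would have nonzero trace. -/
theorem not_detects_errorOp (hl : IsEigenSystem D l) (h0 : jointEigenspace D l ≠ ⊥)
    {w : (Fin n → F) × (Fin n → F)} (hw : w ∉ D) (hwD : ∀ v ∈ D, v.2 ⬝ᵥ w.1 = w.2 ⬝ᵥ v.1) :
    ¬ Detects (jointEigenspace D l) (errorOp w.1 w.2) := by
  rintro ⟨c, hc⟩
  have hmem : ∀ φ ∈ jointEigenspace D l, errorOp w.1 w.2 φ ∈ jointEigenspace D l := by
    intro φ hφ v hv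
    rw [errorOp_comm, hwD v hv, sub_self, AddChar.map_zero_eq_one, one_smul, hφ v hv, map_smul]
  have hsc : ∀ φ ∈ jointEigenspace D l, errorOp w.1 w.2 φ = c • φ := by
    intro φ hφ
    have hm := Submodule.sub_mem _ (hmem φ hφ) (Submodule.smul_mem _ c hφ)
    rw [← sub_eq_zero, ← inner_self_eq_zero (𝕜 := ℂ), inner_sub_right, hc _ hm φ hφ,
      inner_smul_right, sub_self]
  have hcomp : errorOp w.1 w.2 ∘ₗ eigenProj D l = c • eigenProj D l :=
    LinearMap.ext fun ψ => hsc _ ((eigenProj_isProj hl).map_mem ψ)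
  have htr := trace_errorOp_comp_eigenProj (l := l) hw
  rw [hcomp, map_smul, (eigenProj_isProj hl).trace, smul_eq_mul, mul_eq_zero] at htr
  obtain ⟨φ, hφ, hφ0⟩ := (Submodule.ne_bot_iff _).1 h0
  rcases htr with rfl | hr
  · refine hφ0 (errorOp_injective w.1 w.2 ?_)
    rw [hsc φ hφ, zero_smul, map_zero]
  · rw [Nat.cast_eq_zero, Submodule.finrank_eq_zero] at hr
    exact h0 hr

/-- The stabilizer construction: a group `D` of labels that is isotropic for the symplectic form
yields a stabilizer code of dimension `q ^ n / |D|`, and its distance and purity are read off from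
the labels that are orthogonal to `D`. -/
theorem exists_stabilizerCode [DecidableEq F] (D : AddSubgroup ((Fin n → F) × (Fin n → F)))
    (hD : ∀ v ∈ D, ∀ w ∈ D, v.2 ⬝ᵥ w.1 = w.2 ⬝ᵥ v.1) (d : ℕ)
    (hd : ∀ a b : Fin n → F, errorWeight a b < d → errorWeight a b ≠ 0 →
      ∃ v ∈ D, traceChar F (v.2 ⬝ᵥ a - b ⬝ᵥ v.1) ≠ 1)
    (hw : ∃ w ∉ D, errorWeight w.1 w.2 = d ∧ ∀ v ∈ D, v.2 ⬝ᵥ w.1 = w.2 ⬝ᵥ v.1) :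
    ∃ Q : Submodule ℂ (QuditSpace F n), IsStabilizerCode Q ∧
      Nat.card D * Module.finrank ℂ Q = Fintype.card F ^ n ∧
      HasQuantumMinDistance Q d ∧ IsPureTo Q d := by
  obtain ⟨l, hl, h0⟩ := exists_isEigenSystem D hD
  refine ⟨jointEigenspace D l, isStabilizerCode_jointEigenspace hD hl h0,
    card_mul_finrank_jointEigenspace hl, ⟨fun a b hab => ?_, ?_⟩, fun c a b hc hfix => ?_⟩
  · by_cases hab0 : errorWeight a b = 0
    · obtain ⟨rfl, rfl⟩ := errorWeight_eq_zero.1 hab0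
      exact ⟨1, fun u _ v _ => by rw [errorOp_zero, LinearMap.id_apply, one_mul]⟩
    · obtain ⟨v, hv, hχ⟩ := hd a b hab hab0
      exact ⟨0, fun ψ hψ φ hφ => by
        rw [zero_mul, inner_errorOp_eq_zero hl (w := (a, b)) hv hχ hψ hφ]⟩
  · obtain ⟨w, hwD, hwd, horth⟩ := hw
    exact ⟨w.1, w.2, hwd, not_detects_errorOp hl h0 hwD horth⟩
  · by_contra! hcon
    obtain ⟨v, hv, hχ⟩ := hd a b hcon.2 hcon.1
    obtain ⟨φ, hφ, hφ0⟩ := (Submodule.ne_bot_iff _).1 h0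
    have h := inner_errorOp_eq_zero hl (w := (a, b)) hv hχ hφ hφ
    apply hφ0
    rw [← inner_self_eq_zero (𝕜 := ℂ)]
    nth_rewrite 2 [← hfix φ hφ]
    rw [inner_smul_right, h, mul_zero]

end Stabilizer

/-! ### The minimum distance of dual Reed-Muller codes -/

section MinimumDistance

/-- `(r + 1) Q ^ a` for `s = (Q - 1) a + r` with `0 ≤ r < Q - 1`. For `Q = |K|` and
`s < m (Q - 1)` it is the least weight of a nonzero word on `K ^ m` that is orthogonal to all
monomials of degree less than `s`. -/
def dualDist (Q s : ℕ) : ℕ :=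
  (s % (Q - 1) + 1) * Q ^ (s / (Q - 1))

theorem dualDist_zero (Q : ℕ) : dualDist Q 0 = 1 := by
  simp [dualDist]

theorem dualDist_mul_add {N a r : ℕ} (hr : r < N) :
    dualDist (N + 1) (N * a + r) = (r + 1) * (N + 1) ^ a := by
  rw [dualDist, Nat.add_sub_cancel, Nat.mul_add_mod, Nat.mod_eq_of_lt hr,
    Nat.mul_add_div (by lia), Nat.div_eq_of_lt hr, add_zero]

theorem dualDist_add_le {N e : ℕ} (hN : 0 < N) (he : e ≤ N) (s : ℕ) :
    dualDist (N + 1) (s + e) ≤ (e + 1) * dualDist (N + 1) s := by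
  obtain ⟨a, r, hr, rfl⟩ : ∃ a r, r < N ∧ s = N * a + r :=
    ⟨s / N, s % N, Nat.mod_lt _ hN, (Nat.div_add_mod s N).symm⟩
  rw [dualDist_mul_add hr, ← mul_assoc]
  rcases lt_or_ge (r + e) N with h | h
  · rw [add_assoc, dualDist_mul_add h]
    exact Nat.mul_le_mul_right _ (by nlinarith)
  · obtain ⟨u, hu⟩ := Nat.exists_eq_add_of_le h
    rw [add_assoc, hu, ← add_assoc, ← mul_add_one, dualDist_mul_add (by lia), pow_succ',
      ← mul_assoc]
    refine Nat.mul_le_mul_right _ ?_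
    -- With `x = e + 1` and `y = r + 1` this is `(N + 1 - x) * (N + 1 - y) ≥ 0`.
    obtain ⟨x, hx⟩ := Nat.exists_eq_add_of_le he
    obtain ⟨y, hy⟩ := Nat.exists_eq_add_of_lt hr
    zify at *
    have h1 : (u : ℤ) = r + e - N := by linarith
    have h2 : (x : ℤ) = N - e := by linarith
    have h3 : (y : ℤ) = N - r - 1 := by linarith
    have : (0 : ℤ) ≤ x * (y + 1) := by positivity
    rw [h2, h3] at this
    rw [h1]
    nlinarith

theorem dualDist_strictMono {N : ℕ} (hN : 0 < N) : StrictMono (dualDist (N + 1)) := by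
  refine strictMono_nat_of_lt_succ fun s => ?_
  obtain ⟨a, r, hr, rfl⟩ : ∃ a r, r < N ∧ s = N * a + r :=
    ⟨s / N, s % N, Nat.mod_lt _ hN, (Nat.div_add_mod s N).symm⟩
  rw [dualDist_mul_add hr]
  rcases lt_or_ge (r + 1) N with h | h
  · rw [add_assoc, dualDist_mul_add h]
    exact Nat.mul_lt_mul_of_pos_right (by lia) (by positivity)
  · have h' : N * a + r + 1 = N * (a + 1) + 0 := by rw [mul_add_one]; lia
    rw [h', dualDist_mul_add hN, pow_succ', zero_add, one_mul]
    exact Nat.mul_lt_mul_of_pos_right (by lia) (by positivity)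

variable {K : Type*} [Field K]

theorem eval_mem_grmCode {ν m : ℕ} {f : MvPolynomial (Fin m) K} (hf : f.totalDegree ≤ ν) :
    (fun P => MvPolynomial.eval P f) ∈ grmCode K ν m :=
  ⟨f, (MvPolynomial.mem_restrictTotalDegree _ _ _).2 hf, rfl⟩

theorem exists_of_mem_grmCode {ν m : ℕ} {x : (Fin m → K) → K} (hx : x ∈ grmCode K ν m) :
    ∃ f : MvPolynomial (Fin m) K, f.totalDegree ≤ ν ∧ x = fun P => MvPolynomial.eval P f := by
  obtain ⟨f, hf, rfl⟩ := hx
  exact ⟨f, (MvPolynomial.mem_restrictTotalDegree _ _ _).1 hf, rfl⟩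

variable [Fintype K]

theorem grmCode_le_euclideanDual {ν μ m : ℕ} (h : ν + μ < m * (Fintype.card K - 1)) :
    grmCode K μ m ≤ euclideanDual (grmCode K ν m) := by
  intro y hy x hx
  obtain ⟨f, hf, rfl⟩ := exists_of_mem_grmCode hx
  obtain ⟨g, hg, rfl⟩ := exists_of_mem_grmCode hy
  have := MvPolynomial.sum_eval_eq_zero (f * g) (by
    rw [Fintype.card_fin, mul_comm _ m]
    exact (MvPolynomial.totalDegree_mul f g).trans_lt (Nat.lt_of_le_of_lt (Nat.add_le_add hf hg) h))
  simpa using this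

variable [DecidableEq K]

/-- A Vandermonde argument: the power moments of orders below its weight cannot all vanish for a
nonzero function. -/
theorem exists_moment_ne_zero {f : K → K} (hf : f ≠ 0) :
    ∃ j < hammingNorm f, ∑ t, t ^ j * f t ≠ 0 := by
  by_contra! h
  let S : Finset K := {t | f t ≠ 0}
  have hS : S.card = hammingNorm f := rfl
  let e : Fin S.card ≃ S := S.equivFin.symm
  have hv : (fun i => f (e i)) = 0 := by
    refine Matrix.eq_zero_of_forall_pow_sum_mul_pow_eq_zero (f := fun i => (e i : K))
      (Subtype.val_injective.comp e.injective) fun j => ?_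
    rw [← h j (hS ▸ j.2), e.sum_comp fun t : S => f t * (t : K) ^ (j : ℕ),
      Finset.sum_coe_sort S fun t => f t * t ^ (j : ℕ)]
    refine (Finset.sum_subset S.subset_univ fun t _ ht => ?_).trans
      (Finset.sum_congr rfl fun t _ => mul_comm _ _)
    rw [Finset.mem_filter_univ, not_not] at ht
    rw [ht, zero_mul]
  refine hf (funext fun t => ?_)
  by_contra ht
  have := congrFun hv (e.symm ⟨t, by rwa [Finset.mem_filter_univ]⟩)
  simp only [e.apply_symm_apply] at this
  exact ht this

theorem hammingNorm_eq_sum_cons {m : ℕ} (y : (Fin (m + 1) → K) → K) :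
    hammingNorm y = ∑ P : Fin m → K, hammingNorm fun t => y (Fin.cons t P) := by
  simp only [hammingNorm, Finset.card_filter]
  rw [← (Fin.consEquiv fun _ => K).sum_comp, Fintype.sum_prod_type, Finset.sum_comm]
  rfl

/-- The weight bound for words orthogonal to all monomials of degree less than `s`. -/
theorem dualDist_le_hammingNorm {m : ℕ} : ∀ {s : ℕ} {y : (Fin m → K) → K}, y ≠ 0 →
    (∀ e : Fin m → ℕ, ∑ i, e i < s → ∑ P, (∏ i, P i ^ e i) * y P = 0) →
    dualDist (Fintype.card K) s ≤ hammingNorm y := by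
  induction m with
  | zero =>
    intro s y hy h
    rcases Nat.eq_zero_or_pos s with rfl | hs
    · rw [dualDist_zero]
      exact hammingNorm_pos_iff.2 hy
    · have h0 := h 0 (by simpa using hs)
      refine absurd (funext fun P => ?_) hy
      rw [Subsingleton.elim P default]
      simpa using h0
  | succ m ih =>
    intro s y hy h
    -- `z j` is the `j`-th moment of `y` with respect to the first coordinate.
    let z : ℕ → (Fin m → K) → K := fun j P => ∑ t, t ^ j * y (Fin.cons t P)
    have hcol : ∀ P, (fun t => y (Fin.cons t P)) ≠ 0 →
        ∃ j < hammingNorm (fun t => y (Fin.cons t P)), z j P ≠ 0 :=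
      fun P hP => exists_moment_ne_zero hP
    have hex : ∃ j, z j ≠ 0 := by
      obtain ⟨x, hx⟩ := Function.ne_iff.1 hy
      obtain ⟨j, -, hj⟩ := hcol (Fin.tail x) fun h0 => hx (by
        have := congrFun h0 (x 0)
        simpa using this)
      exact ⟨j, fun h0 => hj (congrFun h0 _)⟩
    classical
    let j := Nat.find hex
    have hj : z j ≠ 0 := Nat.find_spec hex
    have hlt : ∀ P, z j P ≠ 0 → j + 1 ≤ hammingNorm (fun t => y (Fin.cons t P)) := by
      intro P hP
      obtain ⟨i, hi, hzi⟩ := hcol P fun h0 => hP (by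
        simp only [z]
        exact Finset.sum_eq_zero fun t _ => by rw [show y (Fin.cons t P) = 0 from congrFun h0 t,
          mul_zero])
      have : j ≤ i := Nat.find_le fun h0 => hzi (congrFun h0 P)
      lia
    have hjK : j + 1 ≤ Fintype.card K := by
      obtain ⟨P, hP⟩ := Function.ne_iff.1 hj
      exact (hlt P hP).trans hammingNorm_le_card_fintype
    have horth : ∀ e : Fin m → ℕ, ∑ i, e i < s - j → ∑ P, (∏ i, P i ^ e i) * z j P = 0 := by
      intro e he
      rw [← h (Fin.cons j e) (by rw [Fin.sum_univ_succ]; simp; lia),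
        ← (Fin.consEquiv fun _ => K).sum_comp, Fintype.sum_prod_type, Finset.sum_comm]
      refine Finset.sum_congr rfl fun P _ => ?_
      rw [Finset.mul_sum]
      refine Finset.sum_congr rfl fun t _ => ?_
      simp [Fin.consEquiv, Fin.prod_univ_succ]
      ring
    obtain ⟨N, hN⟩ : ∃ N, Fintype.card K = N + 1 :=
      Nat.exists_eq_add_one.2 Fintype.card_pos
    have hN0 : 0 < N := by
      have := Fintype.one_lt_card (α := K)
      lia
    calc dualDist (Fintype.card K) s
        = dualDist (N + 1) (s - j + min j s) := by rw [hN]; congr 1; lia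
      _ ≤ (min j s + 1) * dualDist (N + 1) (s - j) := dualDist_add_le hN0 (by lia) _
      _ ≤ (j + 1) * hammingNorm (z j) :=
          Nat.mul_le_mul (by lia) (hN ▸ ih hj horth)
      _ = ∑ P, if z j P ≠ 0 then j + 1 else 0 := by
          rw [← Finset.sum_filter, Finset.sum_const, smul_eq_mul, mul_comm]
          rfl
      _ ≤ ∑ P, hammingNorm fun t => y (Fin.cons t P) := by
          refine Finset.sum_le_sum fun P _ => ?_
          split_ifs with hP
          · exact hlt P hP
          · exact Nat.zero_le _
      _ = hammingNorm y := (hammingNorm_eq_sum_cons y).symm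

theorem dualDist_le_of_mem_euclideanDual {ν m : ℕ} {y : (Fin m → K) → K}
    (hy : y ∈ euclideanDual (grmCode K ν m)) (hy0 : y ≠ 0) :
    dualDist (Fintype.card K) (ν + 1) ≤ hammingNorm y := by
  refine dualDist_le_hammingNorm hy0 fun e he => ?_
  have hdeg : (∏ i, (MvPolynomial.X i : MvPolynomial (Fin m) K) ^ e i).totalDegree ≤ ν := by
    refine (MvPolynomial.totalDegree_finsetProd _ _).trans
      ((Finset.sum_le_sum fun i _ => ?_).trans (Nat.lt_succ_iff.1 he))
    rw [MvPolynomial.totalDegree_X_pow]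
  have := hy _ (eval_mem_grmCode hdeg)
  simpa using this

/-- A minimum weight word of the dual code: the product of indicator functions of `0` in the last
coordinates, of linear factors in one coordinate, and of constants in the first coordinates. -/
theorem exists_mem_grmCode_hammingNorm_eq {s μ m : ℕ} (hμ : s + μ = m * (Fintype.card K - 1))
    (hs : s < m * (Fintype.card K - 1)) :
    ∃ y ∈ grmCode K μ m, hammingNorm y = dualDist (Fintype.card K) s := by
  obtain ⟨N, hN⟩ : ∃ N, Fintype.card K = N + 1 :=
    Nat.exists_eq_add_one.2 Fintype.card_pos
  have hN0 : 0 < N := by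
    have := Fintype.one_lt_card (α := K)
    lia
  obtain ⟨a, r, hr, rfl⟩ : ∃ a r, r < N ∧ s = N * a + r :=
    ⟨s / N, s % N, Nat.mod_lt _ hN0, (Nat.div_add_mod s N).symm⟩
  rw [hN, dualDist_mul_add hr]
  rw [hN, Nat.add_sub_cancel] at hμ hs
  have ham : a < m := by
    by_contra! h
    have := Nat.mul_le_mul_left N h
    rw [mul_comm m] at hs
    lia
  obtain ⟨T, hT⟩ : ∃ T : Finset K, T.card = r + 1 := by
    obtain ⟨T, -, hT⟩ := Finset.exists_subset_card_eq (s := (Finset.univ : Finset K)) (n := r + 1)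
      (by rw [Finset.card_univ]; lia)
    exact ⟨T, hT⟩
  let A : Fin m → Finset K := fun i =>
    if (i : ℕ) < a then Finset.univ else if (i : ℕ) = a then T else {0}
  let f : MvPolynomial (Fin m) K := ∏ i, ∏ t ∈ (A i)ᶜ, (MvPolynomial.X i - MvPolynomial.C t)
  have hcard : ∏ i, (A i).card = (r + 1) * (N + 1) ^ a := by
    obtain ⟨b, rfl⟩ := Nat.exists_eq_add_of_lt ham
    have : a + b + 1 = a + (1 + b) := by lia
    rw [← (finCongr this.symm).prod_comp, Fin.prod_univ_add, Fin.prod_univ_add]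
    simp [A, hT, hN, mul_comm]
  have hcompl : ∑ i, (A i)ᶜ.card = μ := by
    obtain ⟨b, rfl⟩ := Nat.exists_eq_add_of_lt ham
    have : a + b + 1 = a + (1 + b) := by lia
    rw [← Equiv.sum_comp (finCongr this.symm), Fin.sum_univ_add, Fin.sum_univ_add]
    simp [A, hT, hN, Finset.card_compl]
    have : (a + b + 1) * N = N * a + N + b * N := by ring
    lia
  refine ⟨_, eval_mem_grmCode (f := f) ?_, ?_⟩
  · refine (MvPolynomial.totalDegree_finsetProd _ _).trans
      ((Finset.sum_le_sum fun i _ => ?_).trans hcompl.le)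
    refine (MvPolynomial.totalDegree_finsetProd _ _).trans ?_
    rw [Finset.card_eq_sum_ones]
    refine Finset.sum_le_sum fun t _ => (MvPolynomial.totalDegree_sub_C_le _ _).trans ?_
    rw [MvPolynomial.totalDegree_X]
  · rw [← hcard, ← Fintype.card_piFinset]
    rw [hammingNorm]
    congr 1
    ext P
    simp [f, Finset.prod_eq_zero_iff, sub_eq_zero]

/-- The minimum distance of the dual of a generalized Reed-Muller code. -/
theorem hasMinDistance_euclideanDual {ν m : ℕ} (h : ν + 1 < m * (Fintype.card K - 1)) :
    HasMinDistance (euclideanDual (grmCode K ν m)) (dualDist (Fintype.card K) (ν + 1)) := by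
  refine ⟨?_, ?_⟩
  · obtain ⟨μ, hμ⟩ := Nat.exists_eq_add_of_lt h
    obtain ⟨y, hy, hyd⟩ := exists_mem_grmCode_hammingNorm_eq (μ := μ + 1) (by lia) h
    refine ⟨y, grmCode_le_euclideanDual (by lia) hy, ?_, hyd⟩
    rw [← hammingNorm_ne_zero_iff, hyd, dualDist]
    have := Fintype.card_pos (α := K)
    positivity
  · rintro w ⟨x, hx, hx0, rfl⟩
    exact dualDist_le_of_mem_euclideanDual hx hx0

end MinimumDistance

/-! ### The dimension of Reed-Muller codes -/

section Dimension

section Monomials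

variable {K : Type*} [Field K] [Fintype K]

theorem exists_lt_card_pow_eq (d : ℕ) :
    ∃ e < Fintype.card K, e ≤ d ∧ ∀ x : K, x ^ d = x ^ e := by
  induction d using Nat.strong_induction_on with
  | _ d ih =>
    rcases lt_or_ge d (Fintype.card K) with h | h
    · exact ⟨d, h, le_rfl, fun _ => rfl⟩
    · have h1 := Fintype.one_lt_card (α := K)
      obtain ⟨c, rfl⟩ := Nat.exists_eq_add_of_le h
      obtain ⟨e, he, hec, hx⟩ := ih (1 + c) (by lia)
      exact ⟨e, he, by lia, fun x => by
        rw [pow_add, FiniteField.pow_card, ← hx, pow_add, pow_one]⟩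

/-- The word of a reduced monomial, i.e. a monomial with all exponents less than `|K|`. -/
def monomialWord {m : ℕ} (e : Fin m → Fin (Fintype.card K)) : (Fin m → K) → K :=
  fun P => ∏ i, P i ^ (e i : ℕ)

theorem grmCode_eq_span (ν m : ℕ) :
    grmCode K ν m = Submodule.span K (Set.range
      fun e : {e : Fin m → Fin (Fintype.card K) // ∑ i, (e i : ℕ) ≤ ν} => monomialWord e.1) := by
  apply le_antisymm
  · intro x hx
    obtain ⟨f, hf, rfl⟩ := exists_of_mem_grmCode hx
    have hsum : (fun P => MvPolynomial.eval P f) =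
        ∑ d ∈ f.support, f.coeff d • fun P : Fin m → K => ∏ i, P i ^ d i := by
      funext P
      rw [MvPolynomial.eval_eq']
      simp
    rw [hsum]
    refine Submodule.sum_mem _ fun d hd => Submodule.smul_mem _ _ (Submodule.subset_span ?_)
    choose e he hed hx using fun i => exists_lt_card_pow_eq (K := K) (d i)
    refine ⟨⟨fun i => ⟨e i, he i⟩, ?_⟩, ?_⟩
    · refine (Finset.sum_le_sum fun i _ => hed i).trans (le_trans (le_of_eq ?_)
        ((MvPolynomial.le_totalDegree hd).trans hf))
      rw [Finsupp.sum_fintype _ _ fun _ => rfl]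
    · exact funext fun P => Finset.prod_congr rfl fun i _ => (hx i (P i)).symm
  · rw [Submodule.span_le]
    rintro _ ⟨⟨e, he⟩, rfl⟩
    have hdeg : (∏ i, (MvPolynomial.X i : MvPolynomial (Fin m) K) ^ (e i : ℕ)).totalDegree ≤ ν := by
      refine (MvPolynomial.totalDegree_finsetProd _ _).trans
        ((Finset.sum_le_sum fun i _ => ?_).trans he)
      rw [MvPolynomial.totalDegree_X_pow]
    have h := eval_mem_grmCode hdeg
    simp only [map_prod, map_pow, MvPolynomial.eval_X] at h
    exact h

/-- The reduced monomials span all words, and there are as many of them as points. -/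
theorem linearIndependent_monomialWord (m : ℕ) :
    LinearIndependent K (monomialWord : (Fin m → Fin (Fintype.card K)) → (Fin m → K) → K) := by
  classical
  refine linearIndependent_of_top_le_span_of_card_eq_finrank ?_ (by simp)
  rw [← MvPolynomial.map_restrict_dom_evalₗ]
  rintro _ ⟨f, -, rfl⟩
  have h := eval_mem_grmCode (K := K) (f := f) le_rfl
  rw [grmCode_eq_span] at h
  refine Submodule.span_mono ?_ h
  rintro _ ⟨e, rfl⟩
  exact ⟨e.1, rfl⟩

theorem finrank_grmCode (ν m : ℕ) :
    Module.finrank K (grmCode K ν m) =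
      Fintype.card {e : Fin m → Fin (Fintype.card K) // ∑ i, (e i : ℕ) ≤ ν} := by
  rw [grmCode_eq_span]
  exact finrank_span_eq_card
    ((linearIndependent_monomialWord m).comp _ Subtype.val_injective)

end Monomials

/-- The number of monomials of degree at most `s` in `m` variables, which is `0` for `s < 0`. -/
def monomialCount (m : ℕ) (s : ℤ) : ℤ :=
  if 0 ≤ s then ((m + s.toNat).choose m : ℤ) else 0

theorem monomialCount_succ_sub (m : ℕ) (s : ℤ) :
    monomialCount (m + 1) s - monomialCount (m + 1) (s - 1) = monomialCount m s := by
  unfold monomialCount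
  rcases lt_trichotomy s 0 with h | rfl | h
  · rw [if_neg (by lia), if_neg (by lia), if_neg (by lia), sub_zero]
  · simp
  · obtain ⟨k, rfl⟩ : ∃ k : ℕ, s = k + 1 := ⟨(s - 1).toNat, by lia⟩
    rw [if_pos (by lia), if_pos (by lia), if_pos (by lia), add_sub_cancel_right,
      show ((k : ℤ) + 1).toNat = k + 1 by lia, Int.toNat_natCast,
      show m + 1 + (k + 1) = m + 1 + k + 1 by lia, Nat.choose_succ_succ,
      show m + (k + 1) = m + 1 + k by lia]
    push_cast
    ring

theorem sum_monomialCount (Q m : ℕ) (s : ℤ) :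
    ∑ t ∈ Finset.range Q, monomialCount m (s - t) =
      monomialCount (m + 1) s - monomialCount (m + 1) (s - Q) := by
  induction Q with
  | zero => simp
  | succ Q ih =>
    rw [Finset.sum_range_succ, ih, ← monomialCount_succ_sub m (s - Q), sub_add_sub_cancel,
      Nat.cast_succ, sub_sub s]

/-- The alternating sum in the dimension formula, for an integral degree bound. -/
def reducedMonomialCount (Q m : ℕ) (s : ℤ) : ℤ :=
  ∑ j ∈ Finset.range (m + 1), (-1 : ℤ) ^ j * (m.choose j : ℤ) * monomialCount m (s - j * Q)

theorem reducedMonomialCount_natCast (Q m ν : ℕ) :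
    reducedMonomialCount Q m ν = grmDim Q ν m := by
  unfold reducedMonomialCount grmDim monomialCount
  refine Finset.sum_congr rfl fun j _ => ?_
  by_cases h : j * Q ≤ ν
  · have h' : (0 : ℤ) ≤ ν - j * Q := by
      rw [sub_nonneg]
      exact_mod_cast h
    have h2 : ((ν : ℤ) - j * Q).toNat = ν - j * Q := by
      rw [← Nat.cast_mul, Int.toNat_sub]
    rw [if_pos h, if_pos h', h2, Nat.choose_symm_add]
  · have h' : ¬ (0 : ℤ) ≤ ν - j * Q := by
      rw [sub_nonneg]
      exact_mod_cast h
    rw [if_neg h, if_neg h', mul_zero]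

/-- Splitting off the exponent `t` of one variable. -/
theorem reducedMonomialCount_succ (Q m : ℕ) (s : ℤ) :
    reducedMonomialCount Q (m + 1) s =
      ∑ t ∈ Finset.range Q, reducedMonomialCount Q m (s - t) := by
  have hR : ∑ t ∈ Finset.range Q, reducedMonomialCount Q m (s - t) =
      ∑ j ∈ Finset.range (m + 1), (-1 : ℤ) ^ j * (m.choose j : ℤ) *
        (monomialCount (m + 1) (s - j * Q) - monomialCount (m + 1) (s - (j + 1 : ℕ) * Q)) := by
    unfold reducedMonomialCount
    rw [Finset.sum_comm]
    refine Finset.sum_congr rfl fun j _ => ?_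
    rw [← Finset.mul_sum, show s - (j + 1 : ℕ) * (Q : ℤ) = s - j * Q - Q by push_cast; ring,
      ← sum_monomialCount]
    congr 1
    refine Finset.sum_congr rfl fun t _ => ?_
    rw [sub_right_comm]
  have hS : ∑ j ∈ Finset.range (m + 1), (-1 : ℤ) ^ j * (m.choose j : ℤ) *
      monomialCount (m + 1) (s - j * Q) =
      ∑ j ∈ Finset.range (m + 1), (-1 : ℤ) ^ (j + 1) * (m.choose (j + 1) : ℤ) *
        monomialCount (m + 1) (s - (j + 1 : ℕ) * Q) + monomialCount (m + 1) s := by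
    rw [Finset.sum_range_succ', Finset.sum_range_succ _ m, Nat.choose_succ_self]
    simp
  rw [hR]
  simp only [mul_sub]
  rw [Finset.sum_sub_distrib, hS, reducedMonomialCount, Finset.sum_range_succ', add_sub_right_comm,
    ← Finset.sum_sub_distrib]
  congr 1
  · refine Finset.sum_congr rfl fun j _ => ?_
    rw [Nat.choose_succ_succ]
    push_cast
    ring
  · simp

theorem card_reducedExponents (Q m : ℕ) (s : ℤ) :
    (Fintype.card {e : Fin m → Fin Q // ∑ i, ((e i : ℕ) : ℤ) ≤ s} : ℤ) =
      reducedMonomialCount Q m s := by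
  induction m generalizing s with
  | zero =>
    by_cases h : 0 ≤ s <;> simp [reducedMonomialCount, monomialCount, h, Fintype.card_subtype]
  | succ m ih =>
    rw [reducedMonomialCount_succ, Finset.sum_range]
    simp only [← ih]
    simp only [Fintype.card_subtype, Finset.card_filter]
    rw [← (Fin.consEquiv fun _ => Fin Q).sum_comp, Fintype.sum_prod_type]
    push_cast
    refine Finset.sum_congr rfl fun t _ => Finset.sum_congr rfl fun e _ => ?_
    simp only [Fin.consEquiv_apply, Fin.sum_univ_succ, Fin.cons_zero, Fin.cons_succ,
      le_sub_iff_add_le']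

theorem finrank_grmCode_eq_grmDim {K : Type*} [Field K] [Fintype K] (ν m : ℕ) :
    (Module.finrank K (grmCode K ν m) : ℤ) = grmDim (Fintype.card K) ν m := by
  rw [finrank_grmCode, ← reducedMonomialCount_natCast, ← card_reducedExponents]
  norm_cast

end Dimension

/-! ### Stabilizer codes from Hermitian self-orthogonal codes -/

section Hermitian

/-- A quadratic extension `K` of `F`, with the involution `conj` of `K` that fixes `F` and an
element `gen` of `K` that is not fixed. -/
structure QuadraticConj (F K : Type*) [Field F] [Field K] where
  /-- the embedding of the base field -/
  incl : F →+* K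
  /-- the nontrivial automorphism -/
  conj : K →+* K
  /-- an element outside the base field -/
  gen : K
  conj_incl : ∀ a, conj (incl a) = incl a
  conj_conj : ∀ x, conj (conj x) = x
  conj_gen_ne : conj gen ≠ gen

theorem exists_ringHom_of_card_sq {F K : Type*} [Field F] [Fintype F] [Field K] [Fintype K]
    (h : Fintype.card K = Fintype.card F ^ 2) :
    ∃ (p a : ℕ), p.Prime ∧ CharP K p ∧ Fintype.card F = p ^ a ∧ Nonempty (F →+* K) := by
  obtain ⟨p, hFp⟩ := CharP.exists F
  obtain ⟨p', hKp⟩ := CharP.exists K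
  obtain ⟨a, hp, ha⟩ := FiniteField.card F p
  obtain ⟨b, hp', hb⟩ := FiniteField.card K p'
  have hpp : p' = p := by
    have : p' ∣ p ^ ((a : ℕ) * 2) := by
      rw [pow_mul, ← ha, ← h, hb]
      exact dvd_pow_self _ b.ne_zero
    exact (Nat.prime_dvd_prime_iff_eq hp' hp).1 (hp'.dvd_of_dvd_pow this)
  subst hpp
  have : Fact p'.Prime := ⟨hp⟩
  let _ : Algebra (ZMod p') F := ZMod.algebra F p'
  let _ : Algebra (ZMod p') K := ZMod.algebra K p'
  have hdvd : Module.finrank (ZMod p') F ∣ Module.finrank (ZMod p') K := by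
    have h1 := FiniteField.pow_finrank_eq_card p' F
    have h2 := FiniteField.pow_finrank_eq_card p' K
    rw [h, ← h1, ← pow_mul] at h2
    exact ⟨2, Nat.pow_right_injective hp.two_le h2⟩
  obtain ⟨f⟩ := FiniteField.nonempty_algHom_of_finrank_dvd hdvd
  exact ⟨p', a, hp, hKp, ha, ⟨f.toRingHom⟩⟩

theorem exists_quadraticConj {F K : Type*} [Field F] [Fintype F] [Field K] [Fintype K]
    (h : Fintype.card K = Fintype.card F ^ 2) :
    ∃ E : QuadraticConj F K, ∀ x, E.conj x = x ^ Fintype.card F := by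
  obtain ⟨p, a, hp, hK, ha, ⟨f⟩⟩ := exists_ringHom_of_card_sq h
  have : Fact p.Prime := ⟨hp⟩
  have hσ : ∀ x : K, iterateFrobenius K p a x = x ^ Fintype.card F := fun x => by
    rw [iterateFrobenius_def, ha]
  have hgen : ∃ x : K, x ^ Fintype.card F ≠ x := by
    by_contra! hx
    have h1 := Fintype.one_lt_card (α := F)
    have hd : Fintype.card K - 1 ∣ Fintype.card F - 1 := by
      refine (FiniteField.forall_pow_eq_one_iff K _).1 fun u => Units.ext ?_
      rw [Units.val_pow_eq_pow_val, Units.val_one]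
      refine mul_right_cancel₀ u.ne_zero ?_
      rw [← pow_succ, Nat.sub_add_cancel h1.le, hx, one_mul]
    have := Nat.le_of_dvd (by lia) hd
    rw [h] at this
    have : Fintype.card F * 2 ≤ Fintype.card F ^ 2 := by
      rw [sq]
      exact Nat.mul_le_mul_left _ h1
    lia
  obtain ⟨γ, hγ⟩ := hgen
  refine ⟨⟨f, iterateFrobenius K p a, γ, fun x => ?_, fun x => ?_, ?_⟩, hσ⟩
  · rw [hσ, ← map_pow, FiniteField.pow_card]
  · rw [hσ, hσ, ← pow_mul, ← sq, ← h, FiniteField.pow_card]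
  · rwa [hσ]

namespace QuadraticConj

variable {F K : Type*} [Field F] [Field K] (E : QuadraticConj F K)

/-- The coordinates `(a, b) ↦ a + γ b` of `K` over `F`. -/
def pairing : F × F →+ K where
  toFun v := E.incl v.1 + E.gen * E.incl v.2
  map_zero' := by simp
  map_add' v w := by simp only [Prod.fst_add, Prod.snd_add, map_add]; ring

theorem pairing_apply (v : F × F) : E.pairing v = E.incl v.1 + E.gen * E.incl v.2 := rfl

theorem pairing_injective : Function.Injective E.pairing := by
  rw [injective_iff_map_eq_zero]
  rintro ⟨a, b⟩ h
  rw [pairing_apply] at h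
  have h2 := congrArg E.conj h
  simp only [map_add, map_mul, map_zero, E.conj_incl] at h2
  have h3 : (E.conj E.gen - E.gen) * E.incl b = 0 := by linear_combination h2 - h
  have hb := (mul_eq_zero.1 h3).resolve_left (sub_ne_zero.2 E.conj_gen_ne)
  rw [hb, mul_zero, add_zero] at h
  exact Prod.ext ((map_eq_zero _).1 h) ((map_eq_zero _).1 hb)

variable {n : ℕ}

/-- The word over `K` that corresponds to the label of an error operator. -/
def word : (Fin n → F) × (Fin n → F) →+ (Fin n → K) where
  toFun v i := E.pairing (v.1 i, v.2 i)
  map_zero' := funext fun _ => E.pairing.map_zero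
  map_add' v w := funext fun i => E.pairing.map_add (v.1 i, v.2 i) (w.1 i, w.2 i)

theorem word_apply (v : (Fin n → F) × (Fin n → F)) (i : Fin n) :
    E.word v i = E.incl (v.1 i) + E.gen * E.incl (v.2 i) := rfl

theorem word_smul (t : F) (v : (Fin n → F) × (Fin n → F)) :
    E.word (t • v) = E.incl t • E.word v := by
  ext i
  simp only [word_apply, Prod.smul_fst, Prod.smul_snd, Pi.smul_apply, smul_eq_mul, map_mul]
  ring

theorem word_bijective [Fintype F] [Fintype K] (h : Fintype.card K = Fintype.card F ^ 2) :
    Function.Bijective (E.word (n := n)) := by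
  classical
  rw [Fintype.bijective_iff_injective_and_card]
  constructor
  · intro v w hvw
    have := fun i => E.pairing_injective (congrFun hvw i)
    simp only [Prod.mk.injEq] at this
    exact Prod.ext (funext fun i => (this i).1) (funext fun i => (this i).2)
  · simp [h, ← pow_mul, ← pow_add, mul_comm, mul_two]

theorem hammingNorm_word [DecidableEq F] [DecidableEq K] (v : (Fin n → F) × (Fin n → F)) :
    hammingNorm (E.word v) = errorWeight v.1 v.2 :=
  hammingNorm_comp (fun _ => E.pairing) (fun _ => E.pairing_injective) fun _ => E.pairing.map_zero

/-- The skew part of the Hermitian form is the symplectic form on the labels. -/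
theorem hermitian_sub_eq (v w : (Fin n → F) × (Fin n → F)) :
    ∑ i, E.word v i * E.conj (E.word w i) - ∑ i, E.word w i * E.conj (E.word v i) =
      (E.gen - E.conj E.gen) * E.incl (v.2 ⬝ᵥ w.1 - w.2 ⬝ᵥ v.1) := by
  simp only [dotProduct, map_sub, map_sum, map_mul]
  rw [← Finset.sum_sub_distrib, ← Finset.sum_sub_distrib, Finset.mul_sum]
  refine Finset.sum_congr rfl fun i _ => ?_
  simp only [word_apply, map_add, map_mul, E.conj_incl]
  ring

theorem conj_hermitian (x y : Fin n → K) :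
    E.conj (∑ i, x i * E.conj (y i)) = ∑ i, y i * E.conj (x i) := by
  simp only [map_sum, map_mul, E.conj_conj, mul_comm]

theorem symplectic_eq_of_hermitian_eq_zero {v w : (Fin n → F) × (Fin n → F)}
    (h : ∑ i, E.word v i * E.conj (E.word w i) = 0) : v.2 ⬝ᵥ w.1 = w.2 ⬝ᵥ v.1 := by
  have hs := E.hermitian_sub_eq v w
  rw [← E.conj_hermitian (E.word v), h, map_zero, sub_zero, eq_comm, mul_eq_zero, map_eq_zero,
    sub_eq_zero, sub_eq_zero] at hs
  exact hs.resolve_left E.conj_gen_ne.symm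

end QuadraticConj

variable {F K : Type*} [Field F] [Fintype F] [DecidableEq F] [Field K] [Fintype K] [DecidableEq K]
  {n : ℕ}

/-- A Hermitian self-orthogonal code over `K` gives a stabilizer code over `F` whose distance is
the minimum distance of the Hermitian dual. -/
theorem QuadraticConj.exists_stabilizerCode_of_hermitian (E : QuadraticConj F K)
    (hFK : Fintype.card K = Fintype.card F ^ 2) (C : Submodule K (Fin n → K))
    (hC : ∀ x ∈ C, ∀ y ∈ C, ∑ i, x i * E.conj (y i) = 0) (d : ℕ)
    (hd : ∀ x ≠ 0, (∀ y ∈ C, ∑ i, y i * E.conj (x i) = 0) → d ≤ hammingNorm x)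
    (hw : ∃ x ∉ C, hammingNorm x = d ∧ ∀ y ∈ C, ∑ i, y i * E.conj (x i) = 0) :
    ∃ Q : Submodule ℂ (QuditSpace F n), IsStabilizerCode Q ∧
      Nat.card C * Module.finrank ℂ Q = Fintype.card F ^ n ∧
      HasQuantumMinDistance Q d ∧ IsPureTo Q d := by
  have hbij := E.word_bijective (n := n) hFK
  let D : AddSubgroup ((Fin n → F) × (Fin n → F)) := C.toAddSubgroup.comap E.word
  have hmem : ∀ v, v ∈ D ↔ E.word v ∈ C := fun v => Iff.rfl
  have hcard : Nat.card D = Nat.card C :=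
    Nat.card_congr ((Equiv.ofBijective _ hbij).subtypeEquiv fun v => hmem v)
  rw [← hcard]
  refine exists_stabilizerCode D (fun v hv w hw => ?_) d (fun a b hab hab0 => ?_) ?_
  · exact E.symplectic_eq_of_hermitian_eq_zero (hC _ hv _ hw)
  · rw [← E.hammingNorm_word (a, b)] at hab hab0
    obtain ⟨y, hy, hyx⟩ : ∃ y ∈ C, ∑ i, y i * E.conj (E.word (a, b) i) ≠ 0 := by
      by_contra! hcon
      exact hab.not_ge (hd _ (hammingNorm_ne_zero_iff.1 hab0) hcon)
    set h := ∑ i, y i * E.conj (E.word (a, b) i) with hh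
    -- After scaling `y` the Hermitian product is the generator, which has a nonzero skew part.
    obtain ⟨v, hv⟩ := hbij.2 ((E.gen * h⁻¹) • y)
    have hvC : E.word v ∈ C := hv ▸ C.smul_mem _ hy
    have hprod : ∑ i, E.word v i * E.conj (E.word (a, b) i) = E.gen := by
      simp only [hv, Pi.smul_apply, smul_eq_mul, mul_assoc, ← Finset.mul_sum]
      rw [← hh, inv_mul_cancel₀ hyx, mul_one]
    have hs := E.hermitian_sub_eq v (a, b)
    rw [← E.conj_hermitian (E.word v), hprod] at hs
    have hne : v.2 ⬝ᵥ a - b ⬝ᵥ v.1 ≠ 0 := by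
      intro h0
      rw [h0, map_zero, mul_zero] at hs
      exact E.conj_gen_ne (sub_eq_zero.1 hs).symm
    obtain ⟨t, ht⟩ := traceChar_exists_ne_one F hne
    refine ⟨t • v, (hmem _).2 ?_, ?_⟩
    · rw [E.word_smul]
      exact C.smul_mem _ hvC
    · rwa [Prod.smul_snd, Prod.smul_fst, smul_dotProduct, dotProduct_smul, ← smul_sub,
        smul_eq_mul, mul_comm]
  · obtain ⟨x, hxC, hxd, hx⟩ := hw
    obtain ⟨w, rfl⟩ := hbij.2 x
    refine ⟨w, hxC, by rw [← E.hammingNorm_word, hxd], fun v hv => ?_⟩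
    exact E.symplectic_eq_of_hermitian_eq_zero (hx _ hv)

theorem hammingNorm_comp_equiv {α β M : Type*} [Fintype α] [Fintype β] [Zero M] [DecidableEq M]
    (e : α ≃ β) (x : β → M) :
    hammingNorm (x ∘ e) = hammingNorm x := by
  simp only [hammingNorm, Finset.card_filter]
  exact e.sum_comp fun i => if x i ≠ 0 then 1 else 0

/-- The construction for codes on an arbitrary index set with `n` elements. -/
theorem QuadraticConj.exists_stabilizerCode_of_equiv (E : QuadraticConj F K)
    (hFK : Fintype.card K = Fintype.card F ^ 2) {α : Type*} [Fintype α] (e : Fin n ≃ α)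
    (C : Submodule K (α → K))
    (hC : ∀ x ∈ C, ∀ y ∈ C, ∑ i, x i * E.conj (y i) = 0) (d : ℕ)
    (hd : ∀ x ≠ 0, (∀ y ∈ C, ∑ i, y i * E.conj (x i) = 0) → d ≤ hammingNorm x)
    (hw : ∃ x ∉ C, hammingNorm x = d ∧ ∀ y ∈ C, ∑ i, y i * E.conj (x i) = 0) :
    ∃ Q : Submodule ℂ (QuditSpace F n), IsStabilizerCode Q ∧
      Nat.card C * Module.finrank ℂ Q = Fintype.card F ^ n ∧
      HasQuantumMinDistance Q d ∧ IsPureTo Q d := by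
  let ψ : (α → K) ≃ₗ[K] (Fin n → K) := LinearEquiv.funCongrLeft K K e
  have hψ : ∀ x, ψ x = x ∘ e := fun x => rfl
  have hsum : ∀ x y : α → K, ∑ i, ψ x i * E.conj (ψ y i) = ∑ i, x i * E.conj (y i) :=
    fun x y => e.sum_comp fun i => x i * E.conj (y i)
  have hcard : Nat.card (C.map ψ.toLinearMap) = Nat.card C :=
    Nat.card_congr (ψ.submoduleMap C).toEquiv.symm
  rw [← hcard]
  refine E.exists_stabilizerCode_of_hermitian hFK (C.map ψ.toLinearMap) ?_ d ?_ ?_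
  · rintro _ ⟨x, hx, rfl⟩ _ ⟨y, hy, rfl⟩
    exact (hsum x y).trans (hC x hx y hy)
  · intro x hx0 hx
    obtain ⟨x, rfl⟩ := ψ.surjective x
    rw [hψ, hammingNorm_comp_equiv]
    refine hd x (fun h0 => hx0 (by rw [h0, map_zero])) fun y hy => ?_
    rw [← hsum]
    exact hx _ ⟨y, hy, rfl⟩
  · obtain ⟨x, hxC, hxd, hx⟩ := hw
    refine ⟨ψ x, ?_, by rw [hψ, hammingNorm_comp_equiv, hxd], ?_⟩
    · rintro ⟨y, hy, hyx⟩
      exact hxC (ψ.injective hyx ▸ hy)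
    · rintro _ ⟨y, hy, rfl⟩
      exact (hsum y x).trans (hx y hy)

end Hermitian

/-! ### The quantum Reed-Muller codes -/

section QuantumReedMuller

variable {F K : Type*} [Field F] [Fintype F] [DecidableEq F] [Field K] [Fintype K] [DecidableEq K]

theorem exists_stabilizerCode_grmCode (hFK : Fintype.card K = Fintype.card F ^ 2) {ν m : ℕ}
    (hν : ν + 1 ≤ m * (Fintype.card F - 1)) :
    ∃ Q : Submodule ℂ (QuditSpace F (Fintype.card F ^ (2 * m))), IsStabilizerCode Q ∧
      Nat.card (grmCode K ν m) * Module.finrank ℂ Q =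
        Fintype.card F ^ (Fintype.card F ^ (2 * m)) ∧
      HasQuantumMinDistance Q (dualDist (Fintype.card K) (ν + 1)) ∧
      IsPureTo Q (dualDist (Fintype.card K) (ν + 1)) := by
  obtain ⟨E, hE⟩ := exists_quadraticConj hFK
  have e : Fin (Fintype.card F ^ (2 * m)) ≃ (Fin m → K) :=
    (Fintype.equivFinOfCardEq (by simp [hFK, pow_mul])).symm
  obtain ⟨r, hr⟩ : ∃ r, Fintype.card F = r + 2 :=
    ⟨Fintype.card F - 2, by have := Fintype.one_lt_card (α := F); lia⟩
  have hK : Fintype.card K - 1 = (r + 3) * (r + 1) := by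
    rw [hFK, hr, Nat.sub_eq_of_eq_add]
    ring
  rw [hr, show r + 2 - 1 = r + 1 by lia] at hν
  have hlt : (r + 3) * (ν + 1) ≤ m * (Fintype.card K - 1) := by
    rw [hK]
    calc (r + 3) * (ν + 1) ≤ (r + 3) * (m * (r + 1)) := Nat.mul_le_mul_left _ hν
      _ = m * ((r + 3) * (r + 1)) := by ring
  have hconj : ∀ x : (Fin m → K) → K, hammingNorm (fun P => E.conj (x P)) = hammingNorm x :=
    fun x => hammingNorm_comp (fun _ => E.conj) (fun _ => E.conj.injective) fun _ => map_zero _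
  refine E.exists_stabilizerCode_of_equiv hFK e (grmCode K ν m) ?_ _ ?_ ?_
  · intro x hx y hy
    obtain ⟨g, hg, rfl⟩ := exists_of_mem_grmCode hy
    have hgq : (g ^ Fintype.card F).totalDegree ≤ Fintype.card F * ν :=
      (MvPolynomial.totalDegree_pow _ _).trans (Nat.mul_le_mul_left _ hg)
    have hdeg : ν + Fintype.card F * ν < m * (Fintype.card K - 1) := by
      rw [hr]
      nlinarith
    have := grmCode_le_euclideanDual hdeg (eval_mem_grmCode hgq) x hx
    simpa only [hE, map_pow] using this
  · intro x hx0 hx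
    rw [← hconj]
    refine dualDist_le_of_mem_euclideanDual (y := fun P => E.conj (x P)) hx ?_
    rwa [← hammingNorm_ne_zero_iff, hconj, hammingNorm_ne_zero_iff]
  · obtain ⟨⟨y, hy, -, hyd⟩, -⟩ := hasMinDistance_euclideanDual (K := K) (ν := ν) (m := m)
      (by nlinarith)
    refine ⟨fun P => E.conj (y P), fun hmem => ?_, by rw [hconj, hyd], fun z hz => ?_⟩
    · -- Words of the code are orthogonal to polynomials of degree `ν + 1`, so they are heavier.
      have hdual := grmCode_le_euclideanDual (K := K) (ν := ν + 1) (μ := ν) (m := m)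
        (by nlinarith) hmem
      have hy0 : (fun P => E.conj (y P)) ≠ 0 := by
        rw [← hammingNorm_ne_zero_iff, hconj, hyd, dualDist]
        have := Fintype.card_pos (α := K)
        positivity
      have hle := dualDist_le_of_mem_euclideanDual hdual hy0
      rw [hconj, hyd] at hle
      obtain ⟨N, hN⟩ : ∃ N, Fintype.card K = N + 1 := Nat.exists_eq_add_one.2 Fintype.card_pos
      have hN0 : 0 < N := by
        have := Fintype.one_lt_card (α := K)
        lia
      rw [hN] at hle
      exact hle.not_gt (dualDist_strictMono hN0 (Nat.lt_succ_self _))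
    · simp only [E.conj_conj]
      exact hy z hz

end QuantumReedMuller

theorem theorem2 {F K : Type*} [Field F] [Fintype F] [DecidableEq F]
    [Field K] [Fintype K] [DecidableEq K] (q m ν : ℕ)
    (hF : Fintype.card F = q) (hK : Fintype.card K = q ^ 2)
    (hν : (ν : ℤ) ≤ (m : ℤ) * ((q : ℤ) - 1) - 1) :
    (Module.finrank K (grmCode K ν m) : ℤ) = grmDim (q ^ 2) ν m ∧
    HasMinDistance (euclideanDual (grmCode K ν m)) (grmDualDist (q ^ 2) ν) ∧
    ∃ k : ℕ, (k : ℤ) = (q : ℤ) ^ (2 * m) - 2 * grmDim (q ^ 2) ν m ∧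
      ∃ Q : Submodule ℂ (QuditSpace F (q ^ (2 * m))),
        IsPureStabilizerCode Q k (grmDualDist (q ^ 2) ν) := by
  subst hF
  have hq := Fintype.one_lt_card (α := F)
  have hν' : ν + 1 ≤ m * (Fintype.card F - 1) := by
    zify [hq.le]
    linarith
  have hlt : ν + 1 < m * (Fintype.card K - 1) := by
    refine hν'.trans_lt (Nat.mul_lt_mul_of_pos_left ?_ (Nat.pos_of_ne_zero ?_))
    · rw [hK]
      have : Fintype.card F * 2 ≤ Fintype.card F ^ 2 := by
        rw [sq]
        exact Nat.mul_le_mul_left _ hq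
      lia
    · rintro rfl
      lia
  have hdim := finrank_grmCode_eq_grmDim (K := K) ν m
  have hdist := hasMinDistance_euclideanDual (K := K) hlt
  obtain ⟨Q, hQ, hcard, hQd, hQp⟩ := exists_stabilizerCode_grmCode hK hν'
  rw [Module.natCard_eq_pow_finrank (K := K), Nat.card_eq_fintype_card, hK, ← pow_mul] at hcard
  rw [hK] at hdim hdist hQd hQp
  have hle : 2 * Module.finrank K (grmCode K ν m) ≤ Fintype.card F ^ (2 * m) := by
    rw [← Nat.pow_dvd_pow_iff_le_right hq]
    exact Dvd.intro _ hcard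
  refine ⟨hdim, hdist, Fintype.card F ^ (2 * m) - 2 * Module.finrank K (grmCode K ν m), ?_,
    Q, hQ, ?_, hQd, hQp⟩
  · rw [Nat.cast_sub hle, ← hdim]
    push_cast
    ring
  · refine Nat.eq_of_mul_eq_mul_left (pow_pos (zero_lt_one.trans hq)
      (2 * Module.finrank K (grmCode K ν m))) ?_
    rw [hcard, ← pow_add, Nat.add_sub_cancel' hle]
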